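/- Let $k\ge 0$ and $n\ge 1$ be integers, $A\in\mathbb{R}^{k\times n}$, $y\in\mathbb{R}^k$, $\lambda\ge 0$ and $\mu>0$. Write $\mathbf 1\in\mathbb{R}^n$ for the all-ones vector, $\iota_S$ for the indicator function of a set $S$ ($0$ on $S$, $+\infty$ off $S$), and $\mathrm{soft}(\nu,\tau)$ for the componentwise soft threshold $\mathrm{sign}(\nu_i)\max\{|\nu_i|-\tau,0\}$. Put $$f_1(x)=\tfrac12\|Ax-y\|_2^2+\iota_{\{1\}}(\mathbf 1^Tx),\qquad f_2(x)=\lambda\|x\|_1+\iota_{\mathbb{R}^n_+}(x),\qquad F=f_1+f_2 .$$ 1. $f_1$ and $f_2$ are proper, convex and lower semicontinuous. $F:\mathbb{R}^n\to\mathbb{R}\cup\{+\infty\}$ is proper, convex, lower semicontinuous and coercive ($F(x)\to+\infty$ as $\|x\|\to\infty$), and it has a minimizer. Its minimizers are exactly the solutions of the constrained sparse regression (CSR) problem of minimizing $\tfrac12\|Ax-y\|_2^2+\lambda\|x\|_1$ subject to $x\ge 0$, $\mathbf 1^Tx=1$; for $\lambda=0$ these are exactly the solutions of the constrained least squares (CLS)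 problem of minimizing $\tfrac12\|Ax-y\|_2^2$ under the same constraints. 2. Let $B=A^TA+\mu I$. Then $B$ is invertible and $\mathbf 1^TB^{-1}\mathbf 1\ne 0$, so that $C=B^{-1}\mathbf 1(\mathbf 1^TB^{-1}\mathbf 1)^{-1}$ is defined. For all $u,d\in\mathbb{R}^n$, with $w=A^Ty+\mu(u+d)$, the function $x\mapsto f_1(x)+\tfrac{\mu}{2}\|x-u-d\|_2^2$ has the unique minimizer $B^{-1}w-C(\mathbf 1^TB^{-1}w-1)$. For all $x,d\in\mathbb{R}^n$, with $\nu=x-d$, the function $u\mapsto f_2(u)+\tfrac{\mu}{2}\|x-u-d\|_2^2$ has the unique minimizer $\max\{0,\mathrm{soft}(\nu,\lambda/\mu)\}$ (componentwise maximum). 3. Let $u_0,d_0\in\mathbb{R}^n$ be arbitrary, and let the SUnSAL iterates be defined for $j\ge 0$ by $$w_j=A^Ty+\mu(u_j+d_j),\qquad x_{j+1}=B^{-1}w_j-C(\mathbf 1^TB^{-1}w_j-1),$$ $$u_{j+1}=\max\{0,\mathrm{soft}(x_{j+1}-d_j,\lambda/\mu)\},\qquad d_{j+1}=d_j-(x_{j+1}-u_{j+1}).$$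 Then these are iterates of the alternating direction method of multipliers (ADMM) for $\min_x f_1(x)+f_2(Gx)$ with $G=I$: for every $j\ge0$, $x_{j+1}$ minimizes $f_1(x)+\tfrac{\mu}{2}\|x-u_j-d_j\|_2^2$ over $x$, $u_{j+1}$ minimizes $f_2(u)+\tfrac{\mu}{2}\|x_{j+1}-u-d_j\|_2^2$ over $u$, and $d_{j+1}=d_j-(x_{j+1}-u_{j+1})$. Moreover there is a minimizer $x^\ast$ of $F$ such that $x_j\to x^\ast$ and $u_j\to x^\ast$ as $j\to\infty$. -/

import Mathlib

open Filter Topology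
open scoped Matrix

noncomputable section

namespace SUnSAL

/-- `ℝⁿ` with the Euclidean norm. -/
abbrev E (n : ℕ) : Type := EuclideanSpace ℝ (Fin n)

/-- Matrix-vector product on Euclidean spaces. -/
def mv {p n : ℕ} (M : Matrix (Fin p) (Fin n) ℝ) (x : E n) : E p :=
  WithLp.toLp 2 (M *ᵥ x.ofLp)

/-- The all-ones vector. -/
def ones (n : ℕ) : E n := WithLp.toLp 2 (fun _ => 1)

/-- `1ᵀ x`, the sum of the coordinates. -/
def coordSum {n : ℕ} (x : E n) : ℝ := ∑ i, x i

/-- The `ℓ₁` norm. -/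
def l1norm {n : ℕ} (x : E n) : ℝ := ∑ i, |x i|

/-! ### Extended-real-valued functions -/

open Classical in
/-- The convex-analytic indicator function: `0` on `S`, `+∞` off `S`. -/
def indic {X : Type*} (S : Set X) (x : X) : EReal := if x ∈ S then 0 else ⊤

/-- Proper: not identically `+∞`, and never `-∞`. -/
def IsProper {X : Type*} (f : X → EReal) : Prop :=
  (∃ x, f x ≠ ⊤) ∧ ∀ x, f x ≠ ⊥

/-- Convex: the epigraph, a subset of `ℝⁿ × ℝ`, is convex. -/
def IsConvexFun {n : ℕ} (f : E n → EReal) : Prop :=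
  Convex ℝ {q : E n × ℝ | f q.1 ≤ (q.2 : EReal)}

/-- Coercive: `f x → +∞` as `‖x‖ → ∞`. -/
def IsCoerciveFun {n : ℕ} (f : E n → EReal) : Prop :=
  Tendsto f (Bornology.cobounded (E n)) (𝓝 ⊤)

/-- The set of global minimizers. -/
def argmin {X : Type*} (f : X → EReal) : Set X := {x | ∀ z, f x ≤ f z}

/-! ### ADMM for `min f₁ x + f₂ (G x)` -/

/-- Objective of the first ADMM sub-problem. -/
def admmXObj {n p : ℕ} (f₁ : E n → EReal) (G : Matrix (Fin p) (Fin n) ℝ) (μ : ℝ)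
    (u d : E p) (z : E n) : EReal :=
  f₁ z + ((μ / 2 * ‖mv G z - u - d‖ ^ 2 : ℝ) : EReal)

/-- Objective of the second ADMM sub-problem. -/
def admmUObj {n p : ℕ} (f₂ : E p → EReal) (G : Matrix (Fin p) (Fin n) ℝ) (μ : ℝ)
    (x : E n) (d : E p) (v : E p) : EReal :=
  f₂ v + ((μ / 2 * ‖mv G x - v - d‖ ^ 2 : ℝ) : EReal)

/-- The three sequences are generated by ADMM (`x 0` plays no role). -/
structure IsADMM {n p : ℕ} (f₁ : E n → EReal) (f₂ : E p → EReal)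
    (G : Matrix (Fin p) (Fin n) ℝ) (μ : ℝ)
    (x : ℕ → E n) (u d : ℕ → E p) : Prop where
  x_step : ∀ j, x (j + 1) ∈ argmin (admmXObj f₁ G μ (u j) (d j))
  u_step : ∀ j, u (j + 1) ∈ argmin (admmUObj f₂ G μ (x (j + 1)) (d j))
  d_step : ∀ j, d (j + 1) = d j - (mv G (x (j + 1)) - u (j + 1))

/-! ### Constrained sparse regression -/

variable {k n : ℕ}

/-- `L(x) = (1/2)‖Ax - y‖₂² + λ‖x‖₁`. -/
def csrLoss (A : Matrix (Fin k) (Fin n) ℝ) (y : E k) (lam : ℝ) (x : E n) : ℝ :=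
  1 / 2 * ‖mv A x - y‖ ^ 2 + lam * l1norm x

/-- `(1/2)‖Ax - y‖₂²`. -/
def clsLoss (A : Matrix (Fin k) (Fin n) ℝ) (y : E k) (x : E n) : ℝ :=
  1 / 2 * ‖mv A x - y‖ ^ 2

/-- The feasible set `{x | x ≥ 0, 1ᵀx = 1}`. -/
def simplex (n : ℕ) : Set (E n) := {x | x.ofLp ∈ stdSimplex ℝ (Fin n)}

/-- Solutions of the constrained sparse regression problem. -/
def csrSolutions (A : Matrix (Fin k) (Fin n) ℝ) (y : E k) (lam : ℝ) : Set (E n) :=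
  {x | x ∈ simplex n ∧ IsMinOn (csrLoss A y lam) (simplex n) x}

/-- Solutions of the constrained least squares problem. -/
def clsSolutions (A : Matrix (Fin k) (Fin n) ℝ) (y : E k) : Set (E n) :=
  {x | x ∈ simplex n ∧ IsMinOn (clsLoss A y) (simplex n) x}

/-- The nonnegative orthant. -/
def orthant (n : ℕ) : Set (E n) := {x | ∀ i, 0 ≤ x i}

/-- `(1/2)‖Ax - y‖₂² + λ‖x‖₁ + ι_{1}(1ᵀx) + ι_{ℝ₊ⁿ}(x)`. -/
def csrObj (A : Matrix (Fin k) (Fin n) ℝ) (y : E k) (lam : ℝ) (x : E n) : EReal :=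
  (csrLoss A y lam x : EReal) + indic ({1} : Set ℝ) (coordSum x) + indic (orthant n) x

/-- `f₁(x) = (1/2)‖Ax - y‖₂² + ι_{1}(1ᵀx)`. -/
def f1 (A : Matrix (Fin k) (Fin n) ℝ) (y : E k) (x : E n) : EReal :=
  (clsLoss A y x : EReal) + indic ({1} : Set ℝ) (coordSum x)

/-- `f₂(x) = λ‖x‖₁ + ι_{ℝ₊ⁿ}(x)`. -/
def f2 (lam : ℝ) (x : E n) : EReal :=
  ((lam * l1norm x : ℝ) : EReal) + indic (orthant n) x

/-! ### The SUnSAL algorithm -/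

/-- `B = AᵀA + μI`. -/
def matB (A : Matrix (Fin k) (Fin n) ℝ) (μ : ℝ) : Matrix (Fin n) (Fin n) ℝ :=
  Aᵀ * A + μ • (1 : Matrix (Fin n) (Fin n) ℝ)

/-- `C = B⁻¹1 (1ᵀB⁻¹1)⁻¹`. -/
def vecC (A : Matrix (Fin k) (Fin n) ℝ) (μ : ℝ) : E n :=
  (coordSum (mv (matB A μ)⁻¹ (ones n)))⁻¹ • mv (matB A μ)⁻¹ (ones n)

/-- `w = Aᵀy + μ(u + d)`. -/
def vecW (A : Matrix (Fin k) (Fin n) ℝ) (y : E k) (μ : ℝ) (u d : E n) : E n :=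
  mv Aᵀ y + μ • (u + d)

/-- The update `B⁻¹w - C(1ᵀB⁻¹w - 1)`. -/
def xUpdate (A : Matrix (Fin k) (Fin n) ℝ) (y : E k) (μ : ℝ) (u d : E n) : E n :=
  mv (matB A μ)⁻¹ (vecW A y μ u d)
    - (coordSum (mv (matB A μ)⁻¹ (vecW A y μ u d)) - 1) • vecC A μ

/-- Scalar soft threshold `sign(t) max{|t| - τ, 0}`. -/
def soft (t τ : ℝ) : ℝ := Real.sign t * max (|t| - τ) 0

/-- The update `max{0, soft(ν, λ/μ)}`, componentwise. -/
def uUpdate (lam μ : ℝ) (ν : E n) : E n :=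
  WithLp.toLp 2 (fun i => max 0 (soft (ν i) (lam / μ)))

/-- The triple `(x_j, u_j, d_j)`. -/
structure State (n : ℕ) where
  x : E n
  u : E n
  d : E n

/-- One pass through the loop of SUnSAL. -/
def step (A : Matrix (Fin k) (Fin n) ℝ) (y : E k) (lam μ : ℝ) (s : State n) : State n :=
  let x' := xUpdate A y μ s.u s.d
  let u' := uUpdate lam μ (x' - s.d)
  ⟨x', u', s.d - (x' - u')⟩

/-- The SUnSAL iterates. The `x`-component of the initial state is never read. -/
def iterates (A : Matrix (Fin k) (Fin n) ℝ) (y : E k) (lam μ : ℝ) (s₀ : State n) :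
    ℕ → State n
  | 0 => s₀
  | j + 1 => step A y lam μ (iterates A y lam μ s₀ j)

end SUnSAL

end

open SUnSAL

/-!
A pair `(x, p)` with `p ∈ ∂f₁(x)` and `-p ∈ ∂f₂(x)` certifies that `x` minimizes `f₁ + f₂`. ADMM
with `G = I` is the Douglas–Rachford iteration for the monotone operators `μ⁻¹∂f₁` and `μ⁻¹∂f₂`:
monotonicity makes the squared distance from `(u_j, d_j)` to every pair `(x, μ⁻¹p)` decrease by
at least `‖x_{j+1} - u_j‖²` at each step. These residuals are therefore summable, cluster points
of `(u_j, d_j)` are such pairs because subdifferentials have closed graphs, and a cluster point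
to which the distance decreases is a limit. For sparse regression a pair exists: on the simplex
`‖x‖₁ = 1`, so a solution satisfies the first-order condition `⟪Aᵀ(Ax - y), z - x⟫ ≥ 0` there,
and its values at the vertices `z = eᵢ` give `p` explicitly.
-/

namespace SUnSAL

/-! ### Splitting iterations for monotone relations -/

lemma exists_tendsto_of_forall_dist_antitone {X : Type*} [PseudoMetricSpace X] [ProperSpace X]
    {F : Set X} (hF : F.Nonempty) {z : ℕ → X}
    (hdist : ∀ p ∈ F, Antitone fun j => dist (z j) p)
    (hcluster : ∀ p, ∀ φ : ℕ → ℕ, StrictMono φ → Tendsto (z ∘ φ) atTop (𝓝 p) → p ∈ F) :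
    ∃ p ∈ F, Tendsto z atTop (𝓝 p) := by
  obtain ⟨q, hq⟩ := hF
  obtain ⟨p, -, φ, hφ, hp⟩ := tendsto_subseq_of_bounded Metric.isBounded_closedBall
    fun j => Metric.mem_closedBall.2 (hdist q hq j.zero_le)
  have hpF := hcluster p φ hφ hp
  refine ⟨p, hpF, tendsto_iff_dist_tendsto_zero.2 ?_⟩
  rw [tendsto_iff_tendsto_subseq_of_antitone (hdist p hpF) hφ.tendsto_atTop]
  exact tendsto_iff_dist_tendsto_zero.1 hp

lemma tendsto_zero_of_add_le {V r : ℕ → ℝ} (hV : ∀ j, 0 ≤ V j) (hr : ∀ j, 0 ≤ r j)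
    (h : ∀ j, V (j + 1) + r j ≤ V j) : Tendsto r atTop (𝓝 0) := by
  have hsum : ∀ N, ∑ j ∈ Finset.range N, r j ≤ V 0 := fun N =>
    calc ∑ j ∈ Finset.range N, r j ≤ ∑ j ∈ Finset.range N, (V j - V (j + 1)) :=
          Finset.sum_le_sum fun j _ => by linarith [h j]
      _ = V 0 - V N := Finset.sum_range_sub' V N
      _ ≤ V 0 := sub_le_self _ (hV N)
  exact (summable_of_sum_range_le hr hsum).tendsto_atTop_zero

section MonotoneRelations

variable {H : Type*} [NormedAddCommGroup H]

/-- Sequences generated by the Douglas–Rachford splitting of `0 ∈ M x + N x`, in the variables of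
ADMM with unit penalty: the state is `(u j, d j)`, and `x j` is an intermediate point. -/
structure IsSplitting (M N : Set (H × H)) (x u d : ℕ → H) : Prop where
  x_mem : ∀ j, (x (j + 1), u j + d j - x (j + 1)) ∈ M
  u_mem : ∀ j, (u (j + 1), -d (j + 1)) ∈ N
  d_eq : ∀ j, d (j + 1) = d j - (x (j + 1) - u (j + 1))

/-- Pairs `(x, d)` with `d ∈ M x` and `-d ∈ N x`, the fixed points of the splitting. -/
def kktPairs (M N : Set (H × H)) : Set (WithLp 2 (H × H)) :=
  {q | (q.fst, q.snd) ∈ M ∧ (q.fst, -q.snd) ∈ N}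

variable {M N : Set (H × H)} {x u d : ℕ → H}

lemma IsSplitting.mem_kktPairs_of_tendsto (h : IsSplitting M N x u d) (hM : IsClosed M)
    (hN : IsClosed N) (hres : Tendsto (fun j => x (j + 1) - u j) atTop (𝓝 0))
    {q : WithLp 2 (H × H)} {φ : ℕ → ℕ} (hφ : StrictMono φ)
    (hq : Tendsto (fun j => WithLp.toLp 2 (u (φ j), d (φ j))) atTop (𝓝 q)) :
    q ∈ kktPairs M N := by
  have hu : Tendsto (u ∘ φ) atTop (𝓝 q.fst) :=
    ((WithLp.prod_continuous_ofLp 2 H H).fst.tendsto q).comp hq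
  have hd : Tendsto (d ∘ φ) atTop (𝓝 q.snd) :=
    ((WithLp.prod_continuous_ofLp 2 H H).snd.tendsto q).comp hq
  have hres := hres.comp hφ.tendsto_atTop
  have hx : Tendsto (fun j => x (φ j + 1)) atTop (𝓝 q.fst) := by
    simpa [Function.comp_def] using hres.add hu
  have hv : Tendsto (fun j => u (φ j) + d (φ j) - x (φ j + 1)) atTop (𝓝 q.snd) := by
    simpa [Function.comp_def] using (hu.add hd).sub hx
  refine ⟨hM.mem_of_tendsto (hx.prodMk_nhds hv) (.of_forall fun j => h.x_mem (φ j)),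
    hN.mem_of_tendsto (hu.prodMk_nhds hd.neg) ?_⟩
  filter_upwards [hφ.tendsto_atTop.eventually_ge_atTop 1] with j hj
  simpa [Nat.sub_add_cancel hj] using h.u_mem (φ j - 1)

variable [InnerProductSpace ℝ H]

/-- A monotone set-valued operator on `H`, encoded by its graph. -/
def IsMonotoneRel (T : Set (H × H)) : Prop :=
  ∀ a ∈ T, ∀ b ∈ T, 0 ≤ inner ℝ (a.1 - b.1) (a.2 - b.2)

lemma norm_sq_add_norm_sq_add_norm_sq_le_of_inner_nonneg {a b c e : H}
    (hc : 0 ≤ inner ℝ c (e + b - c)) (ha : 0 ≤ inner ℝ a (-(b - (c - a)))) :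
    ‖a‖ ^ 2 + ‖b - (c - a)‖ ^ 2 + ‖c - e‖ ^ 2 ≤ ‖e‖ ^ 2 + ‖b‖ ^ 2 := by
  simp only [← real_inner_self_eq_norm_sq, inner_add_right, inner_sub_left, inner_sub_right,
    inner_neg_right] at *
  linarith [real_inner_comm a b, real_inner_comm a c, real_inner_comm b c, real_inner_comm c e]

lemma IsSplitting.fejer (h : IsSplitting M N x u d) (hM : IsMonotoneRel M) (hN : IsMonotoneRel N)
    {q : WithLp 2 (H × H)} (hq : q ∈ kktPairs M N) (j : ℕ) :
    ‖WithLp.toLp 2 (u (j + 1), d (j + 1)) - q‖ ^ 2 + ‖x (j + 1) - u j‖ ^ 2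
      ≤ ‖WithLp.toLp 2 (u j, d j) - q‖ ^ 2 := by
  have hx := hM _ (h.x_mem j) _ hq.1
  have hu := hN _ (h.u_mem j) _ hq.2
  have key := norm_sq_add_norm_sq_add_norm_sq_le_of_inner_nonneg (a := u (j + 1) - q.fst)
    (b := d j - q.snd) (c := x (j + 1) - q.fst) (e := u j - q.fst)
    (by convert hx using 2; simp only; abel)
    (by convert hu using 2; simp only [h.d_eq j]; abel)
  rw [sub_sub_sub_cancel_right, sub_sub_sub_cancel_right, sub_right_comm, ← h.d_eq j] at key
  rw [WithLp.prod_norm_sq_eq_of_L2, WithLp.prod_norm_sq_eq_of_L2]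
  exact key

lemma IsSplitting.tendsto_sub_zero (h : IsSplitting M N x u d) (hM : IsMonotoneRel M)
    (hN : IsMonotoneRel N) (hne : (kktPairs M N).Nonempty) :
    Tendsto (fun j => x (j + 1) - u j) atTop (𝓝 0) := by
  obtain ⟨q, hq⟩ := hne
  have hsq : Tendsto (fun j => ‖x (j + 1) - u j‖ ^ 2) atTop (𝓝 0) :=
    tendsto_zero_of_add_le (V := fun j => ‖WithLp.toLp 2 (u j, d j) - q‖ ^ 2)
      (fun _ => sq_nonneg _) (fun _ => sq_nonneg _) (h.fejer hM hN hq)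
  rw [tendsto_zero_iff_norm_tendsto_zero]
  simpa using hsq.sqrt

theorem IsSplitting.exists_tendsto [FiniteDimensional ℝ H] (h : IsSplitting M N x u d)
    (hM : IsMonotoneRel M) (hN : IsMonotoneRel N) (hMc : IsClosed M) (hNc : IsClosed N)
    (hne : (kktPairs M N).Nonempty) :
    ∃ q ∈ kktPairs M N, Tendsto x atTop (𝓝 q.fst) ∧ Tendsto u atTop (𝓝 q.fst) := by
  have : FiniteDimensional ℝ (WithLp 2 (H × H)) :=
    (WithLp.linearEquiv 2 ℝ (H × H)).symm.finiteDimensional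
  have : ProperSpace (WithLp 2 (H × H)) := FiniteDimensional.proper ℝ _
  have hres := h.tendsto_sub_zero hM hN hne
  obtain ⟨q, hq, hlim⟩ := exists_tendsto_of_forall_dist_antitone hne
    (z := fun j => WithLp.toLp 2 (u j, d j))
    (fun p hp => antitone_nat_of_succ_le fun j => by
      rw [dist_eq_norm, dist_eq_norm, ← sq_le_sq₀ (norm_nonneg _) (norm_nonneg _)]
      linarith [h.fejer hM hN hp j, sq_nonneg ‖x (j + 1) - u j‖])
    (fun p φ hφ hp => h.mem_kktPairs_of_tendsto hMc hNc hres hφ hp)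
  have hu : Tendsto u atTop (𝓝 q.fst) :=
    ((WithLp.prod_continuous_ofLp 2 H H).fst.tendsto q).comp hlim
  refine ⟨q, hq, ?_, hu⟩
  rw [← tendsto_add_atTop_iff_nat 1]
  simpa using hres.add hu

end MonotoneRelations

/-! ### Subgradients of extended-real-valued functions -/

lemma nonneg_of_isMinOn_of_convex {V : Type*} [NormedAddCommGroup V] [NormedSpace ℝ V] {s : Set V}
    (hs : Convex ℝ s) {g : V → ℝ} {g' : V →L[ℝ] ℝ} {x z : V} (hx : x ∈ s) (hz : z ∈ s)
    (hmin : IsMinOn g s x) (hg : HasFDerivAt g g' x) : 0 ≤ g' (z - x) :=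
  hmin.localize.hasFDerivWithinAt_nonneg hg.hasFDerivWithinAt
    (sub_mem_posTangentConeAt_of_segment_subset (hs.segment_subset hx hz))

lemma IsProper.exists_coe_eq {X : Type*} {f : X → EReal} (hf : IsProper f) {x : X}
    (hx : f x ≠ ⊤) : ∃ a : ℝ, f x = a :=
  ⟨(f x).toReal, (EReal.coe_toReal hx (hf.2 x)).symm⟩

section Subgradient

variable {H : Type*} [NormedAddCommGroup H] [InnerProductSpace ℝ H] {f f₁ f₂ : H → EReal}

/-- `p` is a subgradient of `f` at `x`. For proper `f` this forces `f x` to be finite. -/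
def IsSubgradientAt (f : H → EReal) (p x : H) : Prop :=
  ∀ z, f x + (inner ℝ p (z - x) : ℝ) ≤ f z

lemma IsSubgradientAt.ne_top {p x : H} (h : IsSubgradientAt f p x) (hf : IsProper f) :
    f x ≠ ⊤ := by
  obtain ⟨z, hz⟩ := hf.1
  intro hx
  have hle := h z
  rw [hx, EReal.top_add_coe] at hle
  exact hz (top_le_iff.1 hle)

lemma IsSubgradientAt.mem_argmin_add {p x : H} (h₁ : IsSubgradientAt f₁ p x)
    (h₂ : IsSubgradientAt f₂ (-p) x) : x ∈ argmin fun z => f₁ z + f₂ z := by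
  intro z
  have h := add_le_add (h₁ z) (h₂ z)
  rwa [add_add_add_comm, ← EReal.coe_add, inner_neg_left, add_neg_cancel, EReal.coe_zero,
    add_zero] at h

lemma isSubgradientAt_neg_of_mem_argmin_add (hf : IsProper f)
    (hconv : Convex ℝ {q : H × ℝ | f q.1 ≤ (q.2 : EReal)}) {g : H → ℝ} {p x : H}
    (hg : HasFDerivAt g (innerSL ℝ p) x) (hx : x ∈ argmin fun z => f z + (g z : EReal)) :
    IsSubgradientAt f (-p) x := by
  have hx_top : f x ≠ ⊤ := by
    obtain ⟨z, hz⟩ := hf.1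
    obtain ⟨b, hb⟩ := hf.exists_coe_eq hz
    intro htop
    have hle : f x + g x ≤ f z + g z := hx z
    rw [htop, hb, EReal.top_add_coe, ← EReal.coe_add] at hle
    exact EReal.coe_ne_top _ (top_le_iff.1 hle)
  obtain ⟨a, ha⟩ := hf.exists_coe_eq hx_top
  -- `(x, f x)` minimizes the differentiable function `(z, r) ↦ g z + r` over the epigraph of `f`.
  have hmin : IsMinOn (fun q : H × ℝ => g q.1 + q.2) {q | f q.1 ≤ (q.2 : EReal)} (x, a) := by
    intro q hq
    have hle : f x + g x ≤ q.2 + g q.1 := (hx q.1).trans (add_le_add_left hq _)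
    rw [ha, ← EReal.coe_add, ← EReal.coe_add, EReal.coe_le_coe_iff] at hle
    change g x + a ≤ g q.1 + q.2
    linarith
  have hderiv : HasFDerivAt (fun q : H × ℝ => g q.1 + q.2)
      ((innerSL ℝ p).comp (.fst ℝ H ℝ) + .snd ℝ H ℝ) (x, a) :=
    (hg.comp (x, a) hasFDerivAt_fst).add hasFDerivAt_snd
  intro z
  rcases eq_or_ne (f z) ⊤ with hz | hz
  · exact hz ▸ le_top
  obtain ⟨b, hb⟩ := hf.exists_coe_eq hz
  have h := nonneg_of_isMinOn_of_convex hconv (z := (z, b)) ha.le hb.le hmin hderiv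
  have h : 0 ≤ inner ℝ p (z - x) + (b - a) := h
  rw [ha, hb, ← EReal.coe_add, EReal.coe_le_coe_iff, inner_neg_left]
  linarith

lemma isClosed_setOf_isSubgradientAt (hf : LowerSemicontinuous f) :
    IsClosed {q : H × H | IsSubgradientAt f q.2 q.1} := by
  simp only [IsSubgradientAt, Set.ofPred_forall]
  refine isClosed_iInter fun z => ?_
  have hinner : Continuous fun q : H × H => ((inner ℝ q.2 (z - q.1) : ℝ) : EReal) :=
    continuous_coe_real_ereal.comp (by fun_prop)
  refine LowerSemicontinuous.isClosed_preimage (LowerSemicontinuous.add'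
    (hf.comp continuous_fst) hinner.lowerSemicontinuous fun q => ?_) (f z)
  exact EReal.continuousAt_add (.inr (EReal.coe_ne_bot _)) (.inr (EReal.coe_ne_top _))

lemma IsSubgradientAt.inner_sub_nonneg (hf : IsProper f) {p q x z : H}
    (hx : IsSubgradientAt f p x) (hz : IsSubgradientAt f q z) : 0 ≤ inner ℝ (x - z) (p - q) := by
  obtain ⟨a, ha⟩ := hf.exists_coe_eq (hx.ne_top hf)
  obtain ⟨b, hb⟩ := hf.exists_coe_eq (hz.ne_top hf)
  have h₁ := hx z
  have h₂ := hz x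
  rw [ha, hb, ← EReal.coe_add, EReal.coe_le_coe_iff] at h₁ h₂
  rw [← neg_sub x z, inner_neg_right] at h₁
  rw [real_inner_comm, inner_sub_left]
  linarith

/-- The graph of the rescaled subdifferential `μ⁻¹ ∂f`. -/
def subdifferentialGraph (f : H → EReal) (μ : ℝ) : Set (H × H) :=
  {q | IsSubgradientAt f (μ • q.2) q.1}

lemma isMonotoneRel_subdifferentialGraph (hf : IsProper f) {μ : ℝ} (hμ : 0 < μ) :
    IsMonotoneRel (subdifferentialGraph f μ) := fun a ha b hb => by
  have h := IsSubgradientAt.inner_sub_nonneg hf ha hb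
  rw [← smul_sub, real_inner_smul_right] at h
  exact nonneg_of_mul_nonneg_right h hμ

lemma isClosed_subdifferentialGraph (hf : LowerSemicontinuous f) (μ : ℝ) :
    IsClosed (subdifferentialGraph f μ) :=
  (isClosed_setOf_isSubgradientAt hf).preimage
    (by fun_prop : Continuous fun q : H × H => (q.1, μ • q.2))

/-- The objective `f + (μ / 2) ‖· - s‖²`, whose minimizer is the proximal point of `f` at `s`. -/
noncomputable def proxObj (f : H → EReal) (μ : ℝ) (s z : H) : EReal :=
  f z + ((μ / 2 * ‖z - s‖ ^ 2 : ℝ) : EReal)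

lemma hasFDerivAt_mul_norm_sub_sq (μ : ℝ) (s x : H) :
    HasFDerivAt (fun z => μ / 2 * ‖z - s‖ ^ 2) (innerSL ℝ (μ • (x - s))) x := by
  refine (((hasFDerivAt_id x).sub_const s).norm_sq.const_mul (μ / 2)).congr_fderiv ?_
  ext v
  simp only [id_eq, map_sub, ContinuousLinearMap.comp_id, smul_apply, sub_apply, coe_innerSL_apply,
    nsmul_eq_mul, Nat.cast_ofNat, smul_eq_mul, map_smul]
  ring

lemma isSubgradientAt_of_mem_argmin_proxObj (hf : IsProper f)
    (hconv : Convex ℝ {q : H × ℝ | f q.1 ≤ (q.2 : EReal)}) {μ : ℝ} {s x : H}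
    (hx : x ∈ argmin (proxObj f μ s)) : IsSubgradientAt f (μ • (s - x)) x := by
  have h := isSubgradientAt_neg_of_mem_argmin_add hf hconv (hasFDerivAt_mul_norm_sub_sq μ s x) hx
  rwa [← smul_neg, neg_sub] at h

lemma IsSubgradientAt.proxObj_add_le {μ : ℝ} {s x : H} (h : IsSubgradientAt f (μ • (s - x)) x)
    (z : H) : proxObj f μ s x + ((μ / 2 * ‖z - x‖ ^ 2 : ℝ) : EReal) ≤ proxObj f μ s z := by
  have hexpand : ‖z - s‖ ^ 2 = ‖z - x‖ ^ 2 - 2 * inner ℝ (s - x) (z - x) + ‖x - s‖ ^ 2 := by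
    rw [norm_sub_rev x s, real_inner_comm, ← norm_sub_sq_real, sub_sub_sub_cancel_right]
  calc proxObj f μ s x + ((μ / 2 * ‖z - x‖ ^ 2 : ℝ) : EReal)
      = f x + (inner ℝ (μ • (s - x)) (z - x) : ℝ) + ((μ / 2 * ‖z - s‖ ^ 2 : ℝ) : EReal) := by
        rw [proxObj, add_assoc, add_assoc, ← EReal.coe_add, ← EReal.coe_add, hexpand,
          real_inner_smul_left]
        ring_nf
    _ ≤ proxObj f μ s z := add_le_add_left (h z) _

lemma IsSubgradientAt.argmin_proxObj (hf : IsProper f) {μ : ℝ} (hμ : 0 < μ) {s x : H}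
    (h : IsSubgradientAt f (μ • (s - x)) x) : argmin (proxObj f μ s) = {x} := by
  refine Set.Subset.antisymm (fun z hz => ?_) (Set.singleton_subset_iff.2 fun z => ?_)
  · obtain ⟨a, ha⟩ := hf.exists_coe_eq (h.ne_top hf)
    have hle := (h.proxObj_add_le z).trans (hz x)
    rw [proxObj, ha, ← EReal.coe_add, ← EReal.coe_add, EReal.coe_le_coe_iff,
      add_le_iff_nonpos_right] at hle
    have hsq := nonpos_of_mul_nonpos_right hle (half_pos hμ)
    exact sub_eq_zero.1 (norm_eq_zero.1 (pow_eq_zero_iff two_ne_zero |>.1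
      (hsq.antisymm (sq_nonneg _))))
  · refine le_trans (le_add_of_nonneg_right ?_) (h.proxObj_add_le z)
    exact EReal.coe_nonneg.2 (by positivity)

end Subgradient

/-! ### Convergence of ADMM with `G = I` -/

section ADMM

variable {n : ℕ}

lemma mv_one (x : E n) : mv (1 : Matrix (Fin n) (Fin n) ℝ) x = x := by
  rw [mv, Matrix.one_mulVec]

lemma admmXObj_one (f : E n → EReal) (μ : ℝ) (u d : E n) :
    admmXObj f 1 μ u d = proxObj f μ (u + d) := by
  ext z
  rw [admmXObj, proxObj, mv_one, sub_sub]

lemma admmUObj_one (f : E n → EReal) (μ : ℝ) (x d : E n) :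
    admmUObj f 1 μ x d = proxObj f μ (x - d) := by
  ext z
  rw [admmUObj, proxObj, mv_one, norm_sub_rev z, sub_right_comm]

lemma IsADMM.isSplitting {f₁ f₂ : E n → EReal} {μ : ℝ} {x u d : ℕ → E n}
    (h : IsADMM f₁ f₂ 1 μ x u d) (hf₁ : IsProper f₁) (hc₁ : IsConvexFun f₁) (hf₂ : IsProper f₂)
    (hc₂ : IsConvexFun f₂) :
    IsSplitting (subdifferentialGraph f₁ μ) (subdifferentialGraph f₂ μ) x u d where
  x_mem j := isSubgradientAt_of_mem_argmin_proxObj hf₁ hc₁ (admmXObj_one f₁ μ _ _ ▸ h.x_step j)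
  u_mem j := by
    have hu := isSubgradientAt_of_mem_argmin_proxObj hf₂ hc₂
      (admmUObj_one f₂ μ _ _ ▸ h.u_step j)
    have hd : x (j + 1) - d j - u (j + 1) = -d (j + 1) := by
      rw [h.d_step, mv_one]
      abel
    rwa [hd] at hu
  d_eq j := by rw [h.d_step, mv_one]

theorem IsADMM.exists_tendsto {f₁ f₂ : E n → EReal} {μ : ℝ} {x u d : ℕ → E n}
    (h : IsADMM f₁ f₂ 1 μ x u d) (hμ : 0 < μ)
    (hf₁ : IsProper f₁) (hc₁ : IsConvexFun f₁) (hl₁ : LowerSemicontinuous f₁)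
    (hf₂ : IsProper f₂) (hc₂ : IsConvexFun f₂) (hl₂ : LowerSemicontinuous f₂)
    {x₀ p₀ : E n} (h₁ : IsSubgradientAt f₁ p₀ x₀) (h₂ : IsSubgradientAt f₂ (-p₀) x₀) :
    ∃ xs ∈ argmin fun z => f₁ z + f₂ z,
      Tendsto x atTop (𝓝 xs) ∧ Tendsto u atTop (𝓝 xs) := by
  have hkkt : WithLp.toLp 2 (x₀, μ⁻¹ • p₀) ∈
      kktPairs (subdifferentialGraph f₁ μ) (subdifferentialGraph f₂ μ) := by
    rw [← smul_inv_smul₀ hμ.ne' p₀] at h₁ h₂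
    rw [← smul_neg] at h₂
    exact ⟨h₁, h₂⟩
  obtain ⟨q, ⟨hq₁, hq₂⟩, hx, hu⟩ := (h.isSplitting hf₁ hc₁ hf₂ hc₂).exists_tendsto
    (isMonotoneRel_subdifferentialGraph hf₁ hμ) (isMonotoneRel_subdifferentialGraph hf₂ hμ)
    (isClosed_subdifferentialGraph hl₁ μ) (isClosed_subdifferentialGraph hl₂ μ) ⟨_, hkkt⟩
  have hq₂ : IsSubgradientAt f₂ (μ • -q.snd) q.fst := hq₂
  rw [smul_neg] at hq₂
  exact ⟨q.fst, IsSubgradientAt.mem_argmin_add hq₁ hq₂, hx, hu⟩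

end ADMM

/-! ### Real-valued functions restricted to a set -/

section Indicator

variable {X : Type*} {S T : Set X} {g : X → ℝ} {x : X}

lemma coe_add_indic_of_mem (hx : x ∈ S) (a : ℝ) : (a : EReal) + indic S x = a := by
  rw [indic, if_pos hx, add_zero]

lemma coe_add_indic_of_notMem (hx : x ∉ S) (a : ℝ) : (a : EReal) + indic S x = ⊤ := by
  rw [indic, if_neg hx, EReal.coe_add_top]

lemma coe_add_indic_le_coe_iff {a b : ℝ} : (a : EReal) + indic S x ≤ b ↔ x ∈ S ∧ a ≤ b := by
  by_cases hx : x ∈ S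
  · simp [coe_add_indic_of_mem hx, hx]
  · simp [coe_add_indic_of_notMem hx, hx]

lemma indic_add_indic (S T : Set X) (x : X) : indic S x + indic T x = indic (S ∩ T) x := by
  by_cases hS : x ∈ S <;> by_cases hT : x ∈ T <;> simp [indic, hS, hT]

lemma isProper_coe_add_indic (hS : S.Nonempty) (g : X → ℝ) :
    IsProper fun x => (g x : EReal) + indic S x := by
  obtain ⟨s, hs⟩ := hS
  refine ⟨⟨s, by simp [coe_add_indic_of_mem hs]⟩, fun x => ?_⟩
  by_cases hx : x ∈ S
  · simp [coe_add_indic_of_mem hx]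
  · simp [coe_add_indic_of_notMem hx]

lemma lowerSemicontinuous_coe_add_indic [TopologicalSpace X] (hS : IsClosed S)
    (hg : LowerSemicontinuous g) : LowerSemicontinuous fun x => (g x : EReal) + indic S x := by
  rw [lowerSemicontinuous_iff_isClosed_preimage] at hg ⊢
  intro b
  induction b with
  | bot =>
    have hempty : (fun x => (g x : EReal) + indic S x) ⁻¹' Set.Iic ⊥ = ∅ := by
      ext x
      by_cases hx : x ∈ S
      · simp [coe_add_indic_of_mem hx]
      · simp [coe_add_indic_of_notMem hx]
    exact hempty ▸ isClosed_empty
  | coe b =>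
    have hsublevel : (fun x => (g x : EReal) + indic S x) ⁻¹' Set.Iic (b : EReal)
        = S ∩ g ⁻¹' Set.Iic b := Set.ext fun _ => coe_add_indic_le_coe_iff
    exact hsublevel ▸ hS.inter (hg b)
  | top => simp

lemma argmin_coe_add_indic (hS : S.Nonempty) (g : X → ℝ) :
    argmin (fun x => (g x : EReal) + indic S x) = {x | x ∈ S ∧ IsMinOn g S x} := by
  obtain ⟨s, hs⟩ := hS
  ext x
  simp only [argmin, Set.mem_ofPred_eq, isMinOn_iff]
  constructor
  · intro h
    have hle : ∀ z ∈ S, x ∈ S ∧ g x ≤ g z := fun z hz => by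
      rw [← coe_add_indic_le_coe_iff, ← coe_add_indic_of_mem hz (g z)]
      exact h z
    exact ⟨(hle s hs).1, fun z hz => (hle z hz).2⟩
  · rintro ⟨hx, h⟩ z
    by_cases hz : z ∈ S
    · rw [coe_add_indic_of_mem hz, coe_add_indic_le_coe_iff]
      exact ⟨hx, h z hz⟩
    · rw [coe_add_indic_of_notMem hz]
      exact le_top

lemma isSubgradientAt_coe_add_indic {H : Type*} [NormedAddCommGroup H] [InnerProductSpace ℝ H]
    {S : Set H} {g : H → ℝ} {p x : H} (hx : x ∈ S)
    (h : ∀ z ∈ S, g x + inner ℝ p (z - x) ≤ g z) :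
    IsSubgradientAt (fun z => (g z : EReal) + indic S z) p x := by
  intro z
  simp only [coe_add_indic_of_mem hx]
  by_cases hz : z ∈ S
  · rw [coe_add_indic_of_mem hz]
    exact_mod_cast h z hz
  · rw [coe_add_indic_of_notMem hz]
    exact le_top

lemma isConvexFun_coe_add_indic {n : ℕ} {S : Set (E n)} {g : E n → ℝ} (hg : ConvexOn ℝ S g) :
    IsConvexFun fun x => (g x : EReal) + indic S x := by
  simpa only [IsConvexFun, coe_add_indic_le_coe_iff] using hg.convex_epigraph

lemma isCoerciveFun_coe_add_indic {n : ℕ} {S : Set (E n)} (hS : Bornology.IsBounded S)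
    (g : E n → ℝ) : IsCoerciveFun fun x => (g x : EReal) + indic S x := by
  refine tendsto_nhds_of_eventually_eq ?_
  filter_upwards [Bornology.isBounded_def.1 hS] with x hx
  exact coe_add_indic_of_notMem hx _

end Indicator

/-! ### Coordinates, the matrix `B` and the constraint sets -/

section EuclideanSpaces

variable {k n : ℕ}

lemma mv_eq_toEuclideanLin (M : Matrix (Fin k) (Fin n) ℝ) :
    mv M = Matrix.toEuclideanLin M := rfl

lemma mv_sub (M : Matrix (Fin k) (Fin n) ℝ) (x z : E n) : mv M (x - z) = mv M x - mv M z :=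
  map_sub (Matrix.toEuclideanLin M) x z

lemma mv_smul (M : Matrix (Fin k) (Fin n) ℝ) (c : ℝ) (x : E n) : mv M (c • x) = c • mv M x :=
  map_smul (Matrix.toEuclideanLin M) c x

lemma inner_mv_transpose (M : Matrix (Fin k) (Fin n) ℝ) (a : E k) (b : E n) :
    inner ℝ (mv Mᵀ a) b = inner ℝ a (mv M b) := by
  rw [mv_eq_toEuclideanLin, mv_eq_toEuclideanLin, ← Matrix.conjTranspose_eq_transpose_of_trivial,
    Matrix.toEuclideanLin_conjTranspose_eq_adjoint, LinearMap.adjoint_inner_left]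

lemma inner_eq_sum_mul (x z : E n) : inner ℝ x z = ∑ i, x i * z i := by
  simp [PiLp.inner_apply, mul_comm]

lemma coordSum_eq_inner (x : E n) : coordSum x = inner ℝ (ones n) x := by
  simp [coordSum, ones, inner_eq_sum_mul]

lemma coordSum_sub (x z : E n) : coordSum (x - z) = coordSum x - coordSum z := by
  simp only [coordSum_eq_inner, inner_sub_right]

lemma coordSum_smul (c : ℝ) (x : E n) : coordSum (c • x) = c * coordSum x := by
  simp only [coordSum_eq_inner, real_inner_smul_right]

lemma continuous_coordSum : Continuous (coordSum (n := n)) := by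
  unfold coordSum
  fun_prop

lemma l1norm_eq_coordSum {x : E n} (hx : x ∈ orthant n) : l1norm x = coordSum x :=
  Finset.sum_congr rfl fun i _ => abs_of_nonneg (hx i)

lemma posDef_matB (A : Matrix (Fin k) (Fin n) ℝ) {μ : ℝ} (hμ : 0 < μ) : (matB A μ).PosDef := by
  rw [matB, ← Matrix.conjTranspose_eq_transpose_of_trivial]
  exact Matrix.PosDef.posSemidef_add (Matrix.posSemidef_conjTranspose_mul_self A)
    (Matrix.PosDef.one.smul hμ)

lemma mv_matB (A : Matrix (Fin k) (Fin n) ℝ) (μ : ℝ) (x : E n) :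
    mv (matB A μ) x = mv Aᵀ (mv A x) + μ • x := by
  simp [mv, matB, Matrix.add_mulVec, Matrix.smul_mulVec]

lemma mv_matB_inv (A : Matrix (Fin k) (Fin n) ℝ) {μ : ℝ} (hμ : 0 < μ) (x : E n) :
    mv (matB A μ) (mv (matB A μ)⁻¹ x) = x := by
  have hdet := (Matrix.isUnit_iff_isUnit_det _).1 (posDef_matB A hμ).isUnit
  simp [mv, Matrix.mul_nonsing_inv _ hdet]

lemma coordSum_mv_matB_inv_ones_pos (hn : 1 ≤ n) (A : Matrix (Fin k) (Fin n) ℝ) {μ : ℝ}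
    (hμ : 0 < μ) : 0 < coordSum (mv (matB A μ)⁻¹ (ones n)) := by
  have hones : (ones n).ofLp ≠ 0 := fun h => one_ne_zero (congrFun h ⟨0, hn⟩)
  simpa [coordSum, mv, ones, dotProduct] using
    (posDef_matB A hμ).inv.dotProduct_mulVec_pos hones

/-- The affine hyperplane `1ᵀx = 1` on which `f₁` is finite. -/
def sumOne (n : ℕ) : Set (E n) := {x | coordSum x = 1}

lemma isClosed_sumOne : IsClosed (sumOne n) := isClosed_eq continuous_coordSum continuous_const

lemma convex_sumOne : Convex ℝ (sumOne n) := by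
  simp only [sumOne, coordSum_eq_inner]
  exact convex_hyperplane (innerₗ (E n) (ones n)).isLinear 1

lemma isClosed_orthant : IsClosed (orthant n) := by
  simp only [orthant, Set.ofPred_forall]
  exact isClosed_iInter fun i => isClosed_le continuous_const (by fun_prop)

lemma convex_orthant : Convex ℝ (orthant n) := by
  simp only [orthant, Set.ofPred_forall]
  exact convex_iInter fun i => convex_halfSpace_ge (EuclideanSpace.proj (𝕜 := ℝ) i).isLinear 0

lemma simplex_eq_sumOne_inter_orthant : simplex n = sumOne n ∩ orthant n :=
  Set.ext fun _ => and_comm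

lemma convex_simplex : Convex ℝ (simplex n) :=
  simplex_eq_sumOne_inter_orthant (n := n) ▸ convex_sumOne.inter convex_orthant

lemma single_mem_simplex (i : Fin n) : EuclideanSpace.single i (1 : ℝ) ∈ simplex n :=
  single_mem_stdSimplex ℝ i

lemma simplex_nonempty (hn : 1 ≤ n) : (simplex n).Nonempty := ⟨_, single_mem_simplex ⟨0, hn⟩⟩

lemma isCompact_simplex : IsCompact (simplex n) :=
  (EuclideanSpace.equiv (Fin n) ℝ).toHomeomorph.isCompact_preimage.2
    (isCompact_stdSimplex ℝ (Fin n))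

end EuclideanSpaces

/-! ### The objective and its splitting -/

section Objective

variable {k n : ℕ} (A : Matrix (Fin k) (Fin n) ℝ) (y : E k) (lam : ℝ)

lemma continuous_l1norm : Continuous (l1norm (n := n)) := by
  unfold l1norm
  fun_prop

lemma convexOn_mul_l1norm : ConvexOn ℝ (orthant n) fun x => lam * l1norm x := by
  have hlin : ConvexOn ℝ (orthant n) (lam • innerₗ (E n) (ones n)) :=
    LinearMap.convexOn _ convex_orthant
  exact hlin.congr fun x hx => by
    rw [l1norm_eq_coordSum hx, coordSum_eq_inner]
    rfl

lemma hasFDerivAt_clsLoss (x : E n) :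
    HasFDerivAt (clsLoss A y) (innerSL ℝ (mv Aᵀ (mv A x - y))) x := by
  have hlin : HasFDerivAt (mv A) (Matrix.toEuclideanLin A).toContinuousLinearMap x :=
    (Matrix.toEuclideanLin A).toContinuousLinearMap.hasFDerivAt
  refine ((hasFDerivAt_mul_norm_sub_sq 1 y (mv A x)).comp x hlin).congr_fderiv ?_
  ext v
  rw [one_smul, innerSL_apply_apply, inner_mv_transpose]
  rfl

lemma continuous_clsLoss : Continuous (clsLoss A y) :=
  continuous_iff_continuousAt.2 fun x => (hasFDerivAt_clsLoss A y x).continuousAt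

lemma clsLoss_add_inner_le (x z : E n) :
    clsLoss A y x + inner ℝ (mv Aᵀ (mv A x - y)) (z - x) ≤ clsLoss A y z := by
  have hsplit : mv A z - y = (mv A x - y) + mv A (z - x) := by rw [mv_sub]; abel
  rw [clsLoss, clsLoss, hsplit, norm_add_sq_real, inner_mv_transpose]
  linarith [sq_nonneg ‖mv A (z - x)‖]

lemma convexOn_clsLoss : ConvexOn ℝ Set.univ (clsLoss A y) := by
  have hdist : ConvexOn ℝ Set.univ fun x => dist (mv A x) y :=
    (convexOn_univ_dist y).comp_linearMap (Matrix.toEuclideanLin A)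
  have hsq := (hdist.pow (fun _ _ => dist_nonneg) 2).smul (one_half_pos (α := ℝ)).le
  simp only [dist_eq_norm] at hsq
  exact hsq

lemma continuous_csrLoss : Continuous (csrLoss A y lam) :=
  (continuous_clsLoss A y).add (continuous_const.mul continuous_l1norm)

lemma convexOn_csrLoss : ConvexOn ℝ (orthant n) (csrLoss A y lam) :=
  ((convexOn_clsLoss A y).subset (Set.subset_univ _) convex_orthant).add (convexOn_mul_l1norm lam)

lemma csrLoss_eq_clsLoss_add {x : E n} (hx : x ∈ simplex n) :
    csrLoss A y lam x = clsLoss A y x + lam := by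
  obtain ⟨hsum, hpos⟩ := simplex_eq_sumOne_inter_orthant ▸ hx
  have hsum : coordSum x = 1 := hsum
  rw [csrLoss, clsLoss, l1norm_eq_coordSum hpos, hsum, mul_one]

lemma csrObj_eq :
    csrObj A y lam = fun x => (csrLoss A y lam x : EReal) + indic (simplex n) x := by
  ext x
  rw [csrObj, add_assoc, simplex_eq_sumOne_inter_orthant, ← indic_add_indic]
  rfl

lemma csrObj_eq_f1_add_f2 : csrObj A y lam = fun x => f1 A y x + f2 lam x := by
  ext x
  rw [f1, f2, add_add_add_comm, ← EReal.coe_add, ← add_assoc]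
  rfl

lemma isProper_csrObj (hn : 1 ≤ n) : IsProper (csrObj A y lam) :=
  csrObj_eq A y lam ▸ isProper_coe_add_indic (simplex_nonempty hn) _

lemma isConvexFun_csrObj : IsConvexFun (csrObj A y lam) := by
  have hsub : simplex n ⊆ orthant n :=
    simplex_eq_sumOne_inter_orthant (n := n) ▸ Set.inter_subset_right
  exact csrObj_eq A y lam ▸
    isConvexFun_coe_add_indic ((convexOn_csrLoss A y lam).subset hsub convex_simplex)

lemma lowerSemicontinuous_csrObj : LowerSemicontinuous (csrObj A y lam) :=
  csrObj_eq A y lam ▸ lowerSemicontinuous_coe_add_indic isCompact_simplex.isClosed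
    (continuous_csrLoss A y lam).lowerSemicontinuous

lemma isCoerciveFun_csrObj : IsCoerciveFun (csrObj A y lam) :=
  csrObj_eq A y lam ▸ isCoerciveFun_coe_add_indic isCompact_simplex.isBounded _

lemma argmin_csrObj (hn : 1 ≤ n) : argmin (csrObj A y lam) = csrSolutions A y lam :=
  csrObj_eq A y lam ▸ argmin_coe_add_indic (simplex_nonempty hn) _

lemma csrSolutions_nonempty (hn : 1 ≤ n) : (csrSolutions A y lam).Nonempty :=
  isCompact_simplex.exists_isMinOn (simplex_nonempty hn) (continuous_csrLoss A y lam).continuousOn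

lemma csrSolutions_eq_clsSolutions : csrSolutions A y lam = clsSolutions A y := by
  ext x
  refine and_congr_right fun hx => ?_
  simp only [isMinOn_iff]
  refine forall₂_congr fun z hz => ?_
  rw [csrLoss_eq_clsLoss_add A y lam hx, csrLoss_eq_clsLoss_add A y lam hz, add_le_add_iff_right]

lemma isProper_f1 (hn : 1 ≤ n) : IsProper (f1 A y) :=
  isProper_coe_add_indic (S := sumOne n)
    ((simplex_eq_sumOne_inter_orthant ▸ simplex_nonempty hn).mono Set.inter_subset_left) _

lemma isConvexFun_f1 : IsConvexFun (f1 A y) :=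
  isConvexFun_coe_add_indic ((convexOn_clsLoss A y).subset (Set.subset_univ _) convex_sumOne)

lemma lowerSemicontinuous_f1 : LowerSemicontinuous (f1 A y) :=
  lowerSemicontinuous_coe_add_indic isClosed_sumOne (continuous_clsLoss A y).lowerSemicontinuous

lemma isProper_f2 : IsProper (f2 (n := n) lam) :=
  isProper_coe_add_indic (S := orthant n) ⟨0, fun _ => le_rfl⟩ _

lemma isConvexFun_f2 : IsConvexFun (f2 (n := n) lam) :=
  isConvexFun_coe_add_indic (convexOn_mul_l1norm lam)

lemma lowerSemicontinuous_f2 : LowerSemicontinuous (f2 (n := n) lam) :=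
  lowerSemicontinuous_coe_add_indic isClosed_orthant
    (continuous_const.mul continuous_l1norm).lowerSemicontinuous

end Objective

/-! ### SUnSAL as an instance of ADMM -/

section Algorithm

variable {k n : ℕ} (A : Matrix (Fin k) (Fin n) ℝ) (y : E k) {lam μ : ℝ}

lemma isSubgradientAt_f1 {x : E n} (hx : coordSum x = 1) (c : ℝ) :
    IsSubgradientAt (f1 A y) (mv Aᵀ (mv A x - y) + c • ones n) x := by
  refine isSubgradientAt_coe_add_indic (S := sumOne n) hx fun z hz => ?_
  have hz : coordSum z = 1 := hz
  rw [inner_add_left, real_inner_smul_left, ← coordSum_eq_inner, coordSum_sub, hz, hx, sub_self,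
    mul_zero, add_zero]
  exact clsLoss_add_inner_le A y x z

lemma isSubgradientAt_f2 {x p : E n} (hx : x ∈ orthant n) (hp : ∀ i, p i ≤ lam)
    (hpx : inner ℝ p x = lam * l1norm x) : IsSubgradientAt (f2 lam) p x := by
  refine isSubgradientAt_coe_add_indic hx fun z hz => ?_
  have hpz : inner ℝ p z ≤ lam * l1norm z := by
    rw [l1norm_eq_coordSum hz, coordSum, Finset.mul_sum, inner_eq_sum_mul]
    exact Finset.sum_le_sum fun i _ => mul_le_mul_of_nonneg_right (hp i) (hz i)
  rw [inner_sub_right, hpx]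
  linarith

lemma coordSum_xUpdate (hn : 1 ≤ n) (hμ : 0 < μ) (u d : E n) :
    coordSum (xUpdate A y μ u d) = 1 := by
  rw [xUpdate, vecC, coordSum_sub, coordSum_smul, coordSum_smul,
    inv_mul_cancel₀ (coordSum_mv_matB_inv_ones_pos hn A hμ).ne', mul_one, sub_sub_cancel]

lemma exists_mv_matB_xUpdate_eq (hμ : 0 < μ) (u d : E n) :
    ∃ c : ℝ, mv (matB A μ) (xUpdate A y μ u d) = vecW A y μ u d - c • ones n := by
  rw [xUpdate, vecC, smul_smul, mv_sub, mv_smul, mv_matB_inv A hμ, mv_matB_inv A hμ]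
  exact ⟨_, rfl⟩

lemma isSubgradientAt_f1_xUpdate (hn : 1 ≤ n) (hμ : 0 < μ) (u d : E n) :
    IsSubgradientAt (f1 A y) (μ • (u + d - xUpdate A y μ u d)) (xUpdate A y μ u d) := by
  obtain ⟨c, hc⟩ := exists_mv_matB_xUpdate_eq A y hμ u d
  convert isSubgradientAt_f1 A y (coordSum_xUpdate A y hn hμ u d) c using 1
  rw [mv_matB, vecW, ← eq_sub_iff_add_eq] at hc
  rw [mv_sub, hc]
  module

lemma max_zero_soft {t τ : ℝ} (hτ : 0 ≤ τ) : max 0 (soft t τ) = max 0 (t - τ) := by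
  rcases lt_trichotomy t 0 with ht | rfl | ht
  · have hsoft : soft t τ ≤ 0 := by
      rw [soft, Real.sign_of_neg ht, neg_one_mul]
      exact neg_nonpos.2 (le_max_right _ _)
    rw [max_eq_left hsoft, max_eq_left (by linarith)]
  · rw [soft, Real.sign_zero, zero_mul, zero_sub, max_self, max_eq_left (neg_nonpos.2 hτ)]
  · rw [soft, Real.sign_of_pos ht, abs_of_pos ht, one_mul, max_comm (t - τ), ← max_assoc, max_self]

lemma uUpdate_apply (hlam : 0 ≤ lam) (hμ : 0 ≤ μ) (t : E n) (i : Fin n) :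
    uUpdate lam μ t i = max 0 (t i - lam / μ) :=
  max_zero_soft (div_nonneg hlam hμ)

lemma isSubgradientAt_f2_uUpdate (hlam : 0 ≤ lam) (hμ : 0 < μ) (t : E n) :
    IsSubgradientAt (f2 lam) (μ • (t - uUpdate lam μ t)) (uUpdate lam μ t) := by
  have horth : uUpdate lam μ t ∈ orthant n := fun i => le_max_left _ _
  have hmul : μ * (lam / μ) = lam := mul_div_cancel₀ lam hμ.ne'
  refine isSubgradientAt_f2 horth (fun i => ?_) ?_
  · rw [PiLp.smul_apply, PiLp.sub_apply, uUpdate_apply hlam hμ.le, smul_eq_mul]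
    have hle : t i - max 0 (t i - lam / μ) ≤ lam / μ := by
      linarith [le_max_right 0 (t i - lam / μ)]
    exact (mul_le_mul_of_nonneg_left hle hμ.le).trans_eq hmul
  · rw [l1norm_eq_coordSum horth, coordSum, Finset.mul_sum, inner_eq_sum_mul]
    refine Finset.sum_congr rfl fun i _ => ?_
    rw [PiLp.smul_apply, PiLp.sub_apply, uUpdate_apply hlam hμ.le, smul_eq_mul]
    rcases le_total (t i - lam / μ) 0 with h | h
    · rw [max_eq_left h, mul_zero, mul_zero]
    · rw [max_eq_right h, sub_sub_cancel, hmul]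

lemma exists_isSubgradientAt_of_mem_csrSolutions {x : E n} (hx : x ∈ csrSolutions A y lam) :
    ∃ p, IsSubgradientAt (f1 A y) p x ∧ IsSubgradientAt (f2 lam) (-p) x := by
  obtain ⟨hx, hmin⟩ : x ∈ clsSolutions A y := csrSolutions_eq_clsSolutions A y lam ▸ hx
  obtain ⟨hsum, hpos⟩ := simplex_eq_sumOne_inter_orthant ▸ hx
  have hsum : coordSum x = 1 := hsum
  set q := mv Aᵀ (mv A x - y)
  have hvertex : ∀ i, inner ℝ q x ≤ q i := fun i => by
    have h := nonneg_of_isMinOn_of_convex convex_simplex hx (single_mem_simplex i) hmin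
      (hasFDerivAt_clsLoss A y x)
    rw [innerSL_apply_apply, inner_sub_right, sub_nonneg, EuclideanSpace.inner_single_right] at h
    simpa using h
  -- The multiplier of `1ᵀx = 1` is forced by complementarity, `⟪-p, x⟫ = λ ‖x‖₁ = λ`.
  refine ⟨q + -(inner ℝ q x + lam) • ones n, isSubgradientAt_f1 A y hsum _,
    isSubgradientAt_f2 hpos (fun i => ?_) ?_⟩
  · have h := hvertex i
    simp only [ones, PiLp.neg_apply, PiLp.add_apply, PiLp.smul_apply, smul_eq_mul, mul_one]
    linarith
  · rw [inner_neg_left, inner_add_left, real_inner_smul_left, ← coordSum_eq_inner,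
      l1norm_eq_coordSum hpos, hsum]
    ring

lemma argmin_admmXObj_f1 (hn : 1 ≤ n) (hμ : 0 < μ) (u d : E n) :
    argmin (admmXObj (f1 A y) 1 μ u d) = {xUpdate A y μ u d} := by
  rw [admmXObj_one]
  exact (isSubgradientAt_f1_xUpdate A y hn hμ u d).argmin_proxObj (isProper_f1 A y hn) hμ

lemma argmin_admmUObj_f2 (hlam : 0 ≤ lam) (hμ : 0 < μ) (x d : E n) :
    argmin (admmUObj (f2 lam) 1 μ x d) = {uUpdate lam μ (x - d)} := by
  rw [admmUObj_one]
  exact (isSubgradientAt_f2_uUpdate hlam hμ (x - d)).argmin_proxObj (isProper_f2 lam) hμ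

lemma isADMM_iterates (hn : 1 ≤ n) (hlam : 0 ≤ lam) (hμ : 0 < μ) (s₀ : State n) :
    IsADMM (f1 A y) (f2 lam) 1 μ (fun j => (iterates A y lam μ s₀ j).x)
      (fun j => (iterates A y lam μ s₀ j).u) (fun j => (iterates A y lam μ s₀ j).d) where
  x_step j := by
    rw [argmin_admmXObj_f1 A y hn hμ]
    rfl
  u_step j := by
    rw [argmin_admmUObj_f2 hlam hμ]
    rfl
  d_step j := by
    rw [mv_one]
    rfl

theorem exists_tendsto_iterates (hn : 1 ≤ n) (hlam : 0 ≤ lam) (hμ : 0 < μ) (s₀ : State n) :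
    ∃ xs ∈ argmin (csrObj A y lam),
      Tendsto (fun j => (iterates A y lam μ s₀ j).x) atTop (𝓝 xs) ∧
      Tendsto (fun j => (iterates A y lam μ s₀ j).u) atTop (𝓝 xs) := by
  obtain ⟨x₀, hx₀⟩ := csrSolutions_nonempty A y lam hn
  obtain ⟨p₀, hp₁, hp₂⟩ := exists_isSubgradientAt_of_mem_csrSolutions A y hx₀
  rw [csrObj_eq_f1_add_f2]
  exact (isADMM_iterates A y hn hlam hμ s₀).exists_tendsto hμ
    (isProper_f1 A y hn) (isConvexFun_f1 A y) (lowerSemicontinuous_f1 A y)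
    (isProper_f2 lam) (isConvexFun_f2 lam) (lowerSemicontinuous_f2 lam) hp₁ hp₂

end Algorithm

end SUnSAL


theorem mainTheorem1 {k n : ℕ} (hn : 1 ≤ n) (A : Matrix (Fin k) (Fin n) ℝ)
    (y : EuclideanSpace ℝ (Fin k)) (lam μ : ℝ) (hlam : 0 ≤ lam) (hμ : 0 < μ) :
    -- the objective is proper, convex, lower semicontinuous and coercive, and has a minimizer
    (IsProper (csrObj A y lam) ∧ IsConvexFun (csrObj A y lam) ∧
      LowerSemicontinuous (csrObj A y lam) ∧ IsCoerciveFun (csrObj A y lam)) ∧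
    (argmin (csrObj A y lam)).Nonempty ∧
    -- its minimizers are the solutions of the constrained problem; CLS is the case `lam = 0`
    argmin (csrObj A y lam) = csrSolutions A y lam ∧
    (lam = 0 → csrSolutions A y lam = clsSolutions A y) ∧
    -- the splitting used by ADMM, with `G = I`
    (∀ x : E n, csrObj A y lam x = f1 A y x + f2 lam (mv (1 : Matrix (Fin n) (Fin n) ℝ) x)) ∧
    (IsProper (f1 A y) ∧ IsConvexFun (f1 A y) ∧ LowerSemicontinuous (f1 A y)) ∧
    (IsProper (f2 (n := n) lam) ∧ IsConvexFun (f2 (n := n) lam) ∧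
      LowerSemicontinuous (f2 (n := n) lam)) ∧
    -- the closed-form updates are well defined and are the exact sub-problem solutions
    IsUnit (matB A μ) ∧ coordSum (mv (matB A μ)⁻¹ (ones n)) ≠ 0 ∧
    (∀ u d : E n, argmin (admmXObj (f1 A y) 1 μ u d) = {xUpdate A y μ u d}) ∧
    (∀ x d : E n, argmin (admmUObj (f2 lam) 1 μ x d) = {uUpdate lam μ (x - d)}) ∧
    -- SUnSAL is ADMM, and its iterates converge to a minimizer
    ∀ s₀ : State n,
      IsADMM (f1 A y) (f2 lam) 1 μ (fun j => (iterates A y lam μ s₀ j).x)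
        (fun j => (iterates A y lam μ s₀ j).u) (fun j => (iterates A y lam μ s₀ j).d) ∧
      ∃ xs ∈ argmin (csrObj A y lam),
        Filter.Tendsto (fun j => (iterates A y lam μ s₀ j).x) Filter.atTop (nhds xs) ∧
        Filter.Tendsto (fun j => (iterates A y lam μ s₀ j).u) Filter.atTop (nhds xs) := by
  exact ⟨⟨isProper_csrObj A y lam hn, isConvexFun_csrObj A y lam,
      lowerSemicontinuous_csrObj A y lam, isCoerciveFun_csrObj A y lam⟩,
    argmin_csrObj A y lam hn ▸ csrSolutions_nonempty A y lam hn,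
    argmin_csrObj A y lam hn,
    fun _ => csrSolutions_eq_clsSolutions A y lam,
    fun x => by rw [mv_one, csrObj_eq_f1_add_f2],
    ⟨isProper_f1 A y hn, isConvexFun_f1 A y, lowerSemicontinuous_f1 A y⟩,
    ⟨isProper_f2 lam, isConvexFun_f2 lam, lowerSemicontinuous_f2 lam⟩,
    (posDef_matB A hμ).isUnit,
    (coordSum_mv_matB_inv_ones_pos hn A hμ).ne',
    argmin_admmXObj_f1 A y hn hμ,
    argmin_admmUObj_f2 hlam hμ,
    fun s₀ => ⟨isADMM_iterates A y hn hlam hμ s₀, exists_tendsto_iterates A y hn hlam hμ s₀⟩⟩
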